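/- Let $N\ge 3$ be an integer and $2^{*}=\frac{2N}{N-2}$. For $\phi\in C_0^\infty(\mathbb{R}^N)$ (complex-valued) put $$\|\phi\|_H^2=\int_{\mathbb{R}^N}|x|^{-(N-2)}\left|\nabla\left(|x|^{\frac{N-2}{2}}\phi\right)\right|^2dx+\int_{\mathbb{R}^N}|\phi|^2\,dx ,$$ and let $h(x)=|x|^2$ for $|x|<1$ and $h(x)=1$ for $|x|\ge 1$. Then there is a constant $C>0$, depending only on $N$, such that for every $\phi\in C_0^\infty(\mathbb{R}^N)$ all the integrals involved are finite and $$\|\phi\|_H^2\;\ge\; C\left(\int_{\mathbb{R}^N}h(x)\,|\phi|^{2^{*}}\,dx\right)^{(N-2)/N}.$$ -/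

import Mathlib

open MeasureTheory
open scoped ContDiff

noncomputable section

/-- The squared length `|∇ v (x)|² = ∑ i, |∂ᵢ v (x)|²` of the gradient of a complex-valued function
on `ℝ^N`. -/
def gradSq {N : ℕ} (v : EuclideanSpace ℝ (Fin N) → ℂ) (x : EuclideanSpace ℝ (Fin N)) : ℝ :=
  ∑ i : Fin N, ‖fderiv ℝ v x (EuclideanSpace.single i 1)‖ ^ 2

/-- The function `v(x) = |x|^{(N-2)/2} u(x)`, so that `u = |x|^{-(N-2)/2} v`. -/
def hardyTransform {N : ℕ} (u : EuclideanSpace ℝ (Fin N) → ℂ) (x : EuclideanSpace ℝ (Fin N)) : ℂ :=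
  ((‖x‖ ^ (((N : ℝ) - 2) / 2) : ℝ) : ℂ) * u x

/-- The density `|x|^{-(N-2)} |∇ (|x|^{(N-2)/2} u)|²` of the Hardy part of the energy. For smooth
`u` it is given by classical derivatives at every `x ≠ 0`. -/
def hardyEnergyDensity {N : ℕ} (u : EuclideanSpace ℝ (Fin N) → ℂ)
    (x : EuclideanSpace ℝ (Fin N)) : ℝ :=
  ‖x‖ ^ (-((N : ℝ) - 2)) * gradSq (hardyTransform u) x

/-- The norm of the energy space `H`:
`‖u‖_H² = ∫ |x|^{-(N-2)} |∇ (|x|^{(N-2)/2} u)|² dx + ∫ |u|² dx`. -/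
def energyNorm {N : ℕ} (u : EuclideanSpace ℝ (Fin N) → ℂ) : ℝ :=
  Real.sqrt ((∫ x, hardyEnergyDensity u x) + ∫ x, ‖u x‖ ^ 2)

/-- The critical Sobolev exponent `2* = 2N/(N-2)`. -/
def criticalExponent (N : ℕ) : ℝ := 2 * (N : ℝ) / ((N : ℝ) - 2)

/-- The weight `h(x) = |x|²` for `|x| < 1` and `h(x) = 1` for `|x| ≥ 1`. -/
def hardyWeight {N : ℕ} (x : EuclideanSpace ℝ (Fin N)) : ℝ :=
  if ‖x‖ < 1 then ‖x‖ ^ 2 else 1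

end

/-! Away from the origin the Hardy density is `∑ i, ‖shiftedPartial φ i‖ ^ 2`, with shifted gradient
D = ∇φ + ((N-2)/2)|x|⁻²xφ. It annihilates |x|^{-(N-2)/2}, so it cannot control ∫|φ|²/|x|²; it does
control, with ∫|φ|², the subcritical ∫|x|^{-3/2}|φ|².

The weight h supplies the missing power. Put w = Fφ with F = ((|x|²+ε)/(|x|²+1))^p and p = 1/2*, so
that |w|^{2*} dominates h|φ|^{2*}/2, and apply the Sobolev inequality to w. Then ∇w = F·D + βφx with
|β| ≤ N·F/|x|², and F²/|x|² is at most (|x|²+ε)^{-3/4} + 1 plus the error ε^{2p}/|x|²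
(`regWeight_sq_div_le`). The first term is absorbed by `integral_weight_mul_norm_sq_le`. The error
has a finite integral against |φ|² because N ≥ 3, and vanishes as ε → 0. With ε > 0, w is C¹ across
the origin and no cutoff there is needed. -/

/-- The components of `∇φ + ((N-2)/2) |x|⁻² φ x`, which is `|x|^{-(N-2)/2} ∇(|x|^{(N-2)/2} φ)` away
from the origin. -/
noncomputable def shiftedPartial {N : ℕ} (φ : EuclideanSpace ℝ (Fin N) → ℂ) (i : Fin N)
    (x : EuclideanSpace ℝ (Fin N)) : ℂ :=
  fderiv ℝ φ x (EuclideanSpace.single i 1) + ((((N : ℝ) - 2) / 2) * x i / ‖x‖ ^ 2) • φ x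

/-! ### Radial multiples and the Hardy density -/

lemma hasFDerivAt_comp_norm_sq {N : ℕ} {F : ℝ → ℝ} {F' : ℝ} (x : EuclideanSpace ℝ (Fin N))
    (hF : HasDerivAt F F' (‖x‖ ^ 2)) :
    HasFDerivAt (fun y : EuclideanSpace ℝ (Fin N) => F (‖y‖ ^ 2)) (F' • (2 • innerSL ℝ x)) x :=
  hF.comp_hasFDerivAt x (hasStrictFDerivAt_norm_sq x).hasFDerivAt

lemma inner_single_one {N : ℕ} (x : EuclideanSpace ℝ (Fin N)) (i : Fin N) :
    inner ℝ x (EuclideanSpace.single i (1 : ℝ)) = x i := by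
  simp [EuclideanSpace.inner_single_right]

lemma sum_coord_sq {N : ℕ} (x : EuclideanSpace ℝ (Fin N)) : ∑ i, x i ^ 2 = ‖x‖ ^ 2 :=
  (EuclideanSpace.real_norm_sq_eq x).symm

lemma fderiv_radial_smul_single {N : ℕ} {F : ℝ → ℝ} {F' : ℝ} {φ : EuclideanSpace ℝ (Fin N) → ℂ}
    (x : EuclideanSpace ℝ (Fin N)) (hF : HasDerivAt F F' (‖x‖ ^ 2)) (hφ : DifferentiableAt ℝ φ x)
    (i : Fin N) :
    fderiv ℝ (fun y => F (‖y‖ ^ 2) • φ y) x (EuclideanSpace.single i 1) =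
      F (‖x‖ ^ 2) • fderiv ℝ φ x (EuclideanSpace.single i 1) + (2 * F' * x i) • φ x := by
  have h : HasFDerivAt (fun y => F (‖y‖ ^ 2) • φ y) _ x :=
    (hasFDerivAt_comp_norm_sq x hF).smul hφ.hasFDerivAt
  rw [h.fderiv]
  simp only [add_apply, smul_apply,
    ContinuousLinearMap.smulRight_apply, innerSL_apply_apply, inner_single_one, smul_eq_mul,
    nsmul_eq_mul, Nat.cast_ofNat]
  congr 2
  ring

/-- In terms of `shiftedPartial`, derivatives of a radial multiple of `φ`. -/
lemma fderiv_radial_smul_single_shifted {N : ℕ} {F : ℝ → ℝ} {F' : ℝ}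
    {φ : EuclideanSpace ℝ (Fin N) → ℂ} (x : EuclideanSpace ℝ (Fin N))
    (hF : HasDerivAt F F' (‖x‖ ^ 2)) (hφ : DifferentiableAt ℝ φ x) (i : Fin N) :
    fderiv ℝ (fun y => F (‖y‖ ^ 2) • φ y) x (EuclideanSpace.single i 1) =
      F (‖x‖ ^ 2) • shiftedPartial φ i x +
        (x i * (2 * F' - ((N : ℝ) - 2) / 2 * F (‖x‖ ^ 2) / ‖x‖ ^ 2)) • φ x := by
  rw [fderiv_radial_smul_single x hF hφ, shiftedPartial, smul_add, smul_smul, add_assoc, ← add_smul]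
  congr 2
  ring

lemma hardyEnergyDensity_eq {N : ℕ} {φ : EuclideanSpace ℝ (Fin N) → ℂ}
    {x : EuclideanSpace ℝ (Fin N)} (hx : x ≠ 0) (hφ : DifferentiableAt ℝ φ x) :
    hardyEnergyDensity φ x = ∑ i, ‖shiftedPartial φ i x‖ ^ 2 := by
  set c : ℝ := ((N : ℝ) - 2) / 2 with hc
  have hs : 0 < ‖x‖ := norm_pos_iff.mpr hx
  have hs2 : ‖x‖ ^ 2 ≠ 0 := by positivity
  have hT : hardyTransform φ = fun y => (fun t : ℝ => t ^ (c / 2)) (‖y‖ ^ 2) • φ y := by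
    ext y
    simp only [hardyTransform, Complex.real_smul]
    rw [← Real.rpow_natCast ‖y‖ 2, ← Real.rpow_mul (norm_nonneg _)]
    congr 4
    push_cast; ring
  have hF : HasDerivAt (fun t : ℝ => t ^ (c / 2)) (c / 2 * (‖x‖ ^ 2) ^ (c / 2 - 1)) (‖x‖ ^ 2) :=
    Real.hasDerivAt_rpow_const (Or.inl hs2)
  -- The zeroth-order coefficient vanishes because t^{c/2} solves 2tF' = cF.
  have h0 : 2 * (c / 2 * (‖x‖ ^ 2) ^ (c / 2 - 1)) - c * (‖x‖ ^ 2) ^ (c / 2) / ‖x‖ ^ 2 = 0 := by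
    rw [Real.rpow_sub_one hs2]; ring
  unfold hardyEnergyDensity gradSq
  rw [Finset.mul_sum]
  refine Finset.sum_congr rfl fun i _ => ?_
  rw [hT, fderiv_radial_smul_single_shifted x hF hφ, ← hc, h0, mul_zero, zero_smul, add_zero,
    norm_smul, mul_pow, ← mul_assoc]
  convert one_mul _
  rw [Real.norm_of_nonneg (by positivity), ← Real.rpow_natCast ‖x‖ 2, ← Real.rpow_mul hs.le,
    ← Real.rpow_natCast (_ ^ _) 2, ← Real.rpow_mul hs.le, ← Real.rpow_add hs]
  convert Real.rpow_zero _
  push_cast; rw [hc]; ring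

/-! ### Integrability of the energy -/

lemma Continuous.integrable_norm_sq {N : ℕ} {φ : EuclideanSpace ℝ (Fin N) → ℂ}
    (hφ : Continuous φ) (h : HasCompactSupport φ) : Integrable (fun x => ‖φ x‖ ^ 2) := by
  refine Continuous.integrable_of_hasCompactSupport (by fun_prop) ?_
  exact h.norm.comp_left (g := fun t : ℝ => t ^ 2) (by simp)

/-- |x|⁻² is locally integrable because 2 < N. This gives finite energy and a finite coefficient for
the ε-error. -/
lemma integrable_norm_sq_div_norm_sq {N : ℕ} (hN : 3 ≤ N) {φ : EuclideanSpace ℝ (Fin N) → ℂ}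
    (hφ : Continuous φ) (h : HasCompactSupport φ) :
    Integrable (fun x => ‖φ x‖ ^ 2 / ‖x‖ ^ 2) := by
  obtain ⟨C, hC⟩ := h.exists_bound_of_continuous hφ
  have hN' : (2 : ℝ) < N := by exact_mod_cast hN
  have hm : AEStronglyMeasurable (fun x : EuclideanSpace ℝ (Fin N) => ‖φ x‖ ^ 2 / ‖x‖ ^ 2) :=
    (by fun_prop : Measurable (fun x : EuclideanSpace ℝ (Fin N) =>
      ‖φ x‖ ^ 2 / ‖x‖ ^ 2)).aestronglyMeasurable
  have hl : LocallyIntegrable (fun x : EuclideanSpace ℝ (Fin N) => ‖φ x‖ ^ 2 / ‖x‖ ^ 2) := by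
    refine locallyIntegrable_of_norm_le_rpow (C := C ^ 2) (α := 2) ?_ ?_ ?_ hm
    · simp only [finrank_euclideanSpace, Fintype.card_fin]; lia
    · simpa using hN'
    · refine ae_of_all _ fun x => ?_
      rw [Real.norm_of_nonneg (by positivity), Real.rpow_neg (norm_nonneg _), Real.rpow_two,
        ← div_eq_mul_inv]
      gcongr
      exact hC x
  refine (hl.integrableOn_isCompact h).integrable_of_forall_notMem_eq_zero fun x hx => ?_
  simp [image_eq_zero_of_notMem_tsupport hx]

lemma measurable_shiftedPartial {N : ℕ} {φ : EuclideanSpace ℝ (Fin N) → ℂ}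
    (hφ : ContDiff ℝ ∞ φ) (i : Fin N) : Measurable (shiftedPartial φ i) := by
  have h1 : Measurable φ := hφ.continuous.measurable
  have h2 : Measurable fun x => fderiv ℝ φ x (EuclideanSpace.single i 1) :=
    measurable_fderiv_apply_const ℝ φ _
  unfold shiftedPartial
  fun_prop

lemma norm_sq_shiftedPartial_le {N : ℕ} (φ : EuclideanSpace ℝ (Fin N) → ℂ) (i : Fin N)
    (x : EuclideanSpace ℝ (Fin N)) :
    ‖shiftedPartial φ i x‖ ^ 2 ≤ 2 * ‖fderiv ℝ φ x (EuclideanSpace.single i 1)‖ ^ 2 +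
      2 * (((N : ℝ) - 2) / 2) ^ 2 * (‖φ x‖ ^ 2 / ‖x‖ ^ 2) := by
  have h := norm_add_le (fderiv ℝ φ x (EuclideanSpace.single i 1))
    ((((N : ℝ) - 2) / 2 * x i / ‖x‖ ^ 2) • φ x)
  have hi : x i ^ 2 / (‖x‖ ^ 2) ^ 2 ≤ 1 / ‖x‖ ^ 2 := by
    rcases eq_or_ne x 0 with rfl | hx
    · simp
    have hs : 0 < ‖x‖ := norm_pos_iff.mpr hx
    rw [div_le_div_iff₀ (by positivity) (by positivity), one_mul, sq (‖x‖ ^ 2)]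
    refine mul_le_mul_of_nonneg_right ?_ (by positivity)
    rw [← sum_coord_sq x]
    exact Finset.single_le_sum (f := fun i => x i ^ 2) (fun _ _ => sq_nonneg _) (Finset.mem_univ i)
  calc ‖shiftedPartial φ i x‖ ^ 2 ≤ (‖fderiv ℝ φ x (EuclideanSpace.single i 1)‖ +
      ‖(((N : ℝ) - 2) / 2 * x i / ‖x‖ ^ 2) • φ x‖) ^ 2 := by gcongr; exact h
    _ ≤ 2 * (‖fderiv ℝ φ x (EuclideanSpace.single i 1)‖ ^ 2 +
      ‖(((N : ℝ) - 2) / 2 * x i / ‖x‖ ^ 2) • φ x‖ ^ 2) := add_sq_le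
    _ = 2 * ‖fderiv ℝ φ x (EuclideanSpace.single i 1)‖ ^ 2 +
        2 * (((N : ℝ) - 2) / 2) ^ 2 * (‖φ x‖ ^ 2 * (x i ^ 2 / (‖x‖ ^ 2) ^ 2)) := by
      rw [norm_smul, mul_pow, Real.norm_eq_abs, sq_abs]; ring
    _ ≤ _ := by rw [div_eq_mul_one_div (‖φ x‖ ^ 2)]; gcongr

lemma integrable_norm_sq_partial {N : ℕ} {φ : EuclideanSpace ℝ (Fin N) → ℂ}
    (hφ : ContDiff ℝ ∞ φ) (h : HasCompactSupport φ) (v : EuclideanSpace ℝ (Fin N)) :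
    Integrable (fun x => ‖fderiv ℝ φ x v‖ ^ 2) :=
  Continuous.integrable_norm_sq
    ((hφ.continuous_fderiv (by simp)).clm_apply continuous_const) (h.fderiv_apply ℝ v)

lemma integrable_norm_sq_shiftedPartial {N : ℕ} (hN : 3 ≤ N) {φ : EuclideanSpace ℝ (Fin N) → ℂ}
    (hφ : ContDiff ℝ ∞ φ) (h : HasCompactSupport φ) (i : Fin N) :
    Integrable (fun x => ‖shiftedPartial φ i x‖ ^ 2) := by
  refine Integrable.mono' (((integrable_norm_sq_partial hφ h (EuclideanSpace.single i 1)).const_mul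
    2).add ((integrable_norm_sq_div_norm_sq hN hφ.continuous h).const_mul
      (2 * (((N : ℝ) - 2) / 2) ^ 2))) ?_ (ae_of_all _ fun x => ?_)
  · exact ((measurable_shiftedPartial hφ i).norm.pow_const 2).aestronglyMeasurable
  · rw [Real.norm_of_nonneg (by positivity)]
    exact norm_sq_shiftedPartial_le φ i x

lemma hardyEnergyDensity_ae_eq {N : ℕ} (hN : 3 ≤ N) {φ : EuclideanSpace ℝ (Fin N) → ℂ}
    (hφ : ContDiff ℝ ∞ φ) :
    hardyEnergyDensity φ =ᵐ[volume] fun x => ∑ i, ‖shiftedPartial φ i x‖ ^ 2 := by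
  have : Nonempty (Fin N) := ⟨⟨0, by lia⟩⟩
  filter_upwards [Measure.ae_ne volume (0 : EuclideanSpace ℝ (Fin N))] with x hx
  exact hardyEnergyDensity_eq hx (hφ.differentiable (by simp) x)

lemma integrable_sum_norm_sq_shiftedPartial {N : ℕ} (hN : 3 ≤ N)
    {φ : EuclideanSpace ℝ (Fin N) → ℂ} (hφ : ContDiff ℝ ∞ φ) (h : HasCompactSupport φ) :
    Integrable (fun x => ∑ i, ‖shiftedPartial φ i x‖ ^ 2) :=
  integrable_finsetSum _ fun i _ => integrable_norm_sq_shiftedPartial hN hφ h i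

/-! ### Subcritical Hardy inequality by the divergence theorem -/

/-- The integral of the divergence of `x η(|x|²) |φ|²` vanishes. -/
lemma integral_div_radial_field_eq_zero {N : ℕ} {η η' : ℝ → ℝ}
    (hη : ∀ s, 0 ≤ s → HasDerivAt η (η' s) s) (hη' : ContinuousOn η' (Set.Ici 0))
    {φ : EuclideanSpace ℝ (Fin N) → ℂ} (hφ : ContDiff ℝ ∞ φ) (h : HasCompactSupport φ) :
    Integrable (fun x => (N * η (‖x‖ ^ 2) + 2 * ‖x‖ ^ 2 * η' (‖x‖ ^ 2)) * ‖φ x‖ ^ 2 +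
      2 * η (‖x‖ ^ 2) * ∑ i, x i * inner ℝ (φ x) (fderiv ℝ φ x (EuclideanSpace.single i 1))) ∧
    ∫ x, ((N * η (‖x‖ ^ 2) + 2 * ‖x‖ ^ 2 * η' (‖x‖ ^ 2)) * ‖φ x‖ ^ 2 +
      2 * η (‖x‖ ^ 2) * ∑ i, x i * inner ℝ (φ x) (fderiv ℝ φ x (EuclideanSpace.single i 1))) = 0 := by
  have cη : Continuous fun x : EuclideanSpace ℝ (Fin N) => η (‖x‖ ^ 2) :=
    continuous_iff_continuousAt.mpr fun x => ContinuousAt.comp (f := fun x => ‖x‖ ^ 2)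
      (hη _ (by positivity)).continuousAt (by fun_prop)
  have cη' : Continuous fun x : EuclideanSpace ℝ (Fin N) => η' (‖x‖ ^ 2) :=
    hη'.comp_continuous (by fun_prop) fun x => by simp
  have cφ := hφ.continuous
  have cd : ∀ v, Continuous fun x => fderiv ℝ φ x v := fun v =>
    (hφ.continuous_fderiv (by simp)).clm_apply continuous_const
  have hs : ∀ {f : EuclideanSpace ℝ (Fin N) → ℝ}, Continuous f → (∀ x, φ x = 0 → f x = 0) →
      Integrable f := fun hf hf0 => hf.integrable_of_hasCompactSupport <|
    h.mono fun x hx => by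
      simp only [Function.mem_support] at hx ⊢
      exact fun h0 => hx (hf0 x h0)
  have dφ : ∀ x, HasFDerivAt (fun x => ‖φ x‖ ^ 2) (2 • (innerSL ℝ (φ x)).comp (fderiv ℝ φ x)) x :=
    fun x => ((hφ.differentiable (by simp) x).hasFDerivAt).norm_sq
  have df : ∀ (i : Fin N) (x : EuclideanSpace ℝ (Fin N)),
      HasFDerivAt (fun x : EuclideanSpace ℝ (Fin N) => x i * η (‖x‖ ^ 2))
      (x i • (η' (‖x‖ ^ 2) • (2 • innerSL ℝ x)) + η (‖x‖ ^ 2) • EuclideanSpace.proj i) x :=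
    fun i x => (EuclideanSpace.proj (𝕜 := ℝ) i).hasFDerivAt.mul
      (hasFDerivAt_comp_norm_sq x (hη _ (by positivity)))
  have key : ∀ i : Fin N, Integrable (fun x => (η (‖x‖ ^ 2) + 2 * x i ^ 2 * η' (‖x‖ ^ 2)) * ‖φ x‖ ^ 2
      + 2 * η (‖x‖ ^ 2) * (x i * inner ℝ (φ x) (fderiv ℝ φ x (EuclideanSpace.single i 1)))) ∧
      ∫ x, ((η (‖x‖ ^ 2) + 2 * x i ^ 2 * η' (‖x‖ ^ 2)) * ‖φ x‖ ^ 2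
      + 2 * η (‖x‖ ^ 2) * (x i * inner ℝ (φ x) (fderiv ℝ φ x (EuclideanSpace.single i 1)))) = 0 := by
    intro i
    have cdi := cd (EuclideanSpace.single i 1)
    have ci : Continuous fun x : EuclideanSpace ℝ (Fin N) => x i := by fun_prop
    have i1 : Integrable fun x : EuclideanSpace ℝ (Fin N) =>
        (η (‖x‖ ^ 2) + 2 * x i ^ 2 * η' (‖x‖ ^ 2)) * ‖φ x‖ ^ 2 :=
      hs ((cη.add ((continuous_const.mul (ci.pow 2)).mul cη')).mul (cφ.norm.pow 2)) fun x hx => by simp [hx]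
    have i2 : Integrable fun x : EuclideanSpace ℝ (Fin N) => 2 * η (‖x‖ ^ 2) *
        (x i * inner ℝ (φ x) (fderiv ℝ φ x (EuclideanSpace.single i 1))) :=
      hs ((continuous_const.mul cη).mul (ci.mul (cφ.inner cdi))) fun x hx => by simp [hx]
    refine ⟨i1.add i2, ?_⟩
    rw [integral_add i1 i2]
    have e1 : ∀ x : EuclideanSpace ℝ (Fin N),
        fderiv ℝ (fun x : EuclideanSpace ℝ (Fin N) => x i * η (‖x‖ ^ 2)) x
        (EuclideanSpace.single i 1) * ‖φ x‖ ^ 2 =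
        (η (‖x‖ ^ 2) + 2 * x i ^ 2 * η' (‖x‖ ^ 2)) * ‖φ x‖ ^ 2 := fun x => by
      have hproj : EuclideanSpace.proj (𝕜 := ℝ) i (EuclideanSpace.single i 1) = 1 := by simp
      rw [(df i x).fderiv]
      simp only [add_apply, smul_apply, innerSL_apply_apply, inner_single_one, smul_eq_mul,
        nsmul_eq_mul, Nat.cast_ofNat, hproj]
      ring
    have e2 : ∀ x : EuclideanSpace ℝ (Fin N),
        x i * η (‖x‖ ^ 2) * fderiv ℝ (fun x => ‖φ x‖ ^ 2) x (EuclideanSpace.single i 1) =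
        2 * η (‖x‖ ^ 2) * (x i * inner ℝ (φ x) (fderiv ℝ φ x (EuclideanSpace.single i 1))) :=
      fun x => by
      rw [(dφ x).fderiv]
      simp only [smul_apply, ContinuousLinearMap.comp_apply,
        innerSL_apply_apply, nsmul_eq_mul, Nat.cast_ofNat]
      ring
    have hibp := integral_mul_fderiv_eq_neg_fderiv_mul_of_integrable (μ := volume)
      (f := fun x : EuclideanSpace ℝ (Fin N) => x i * η (‖x‖ ^ 2)) (g := fun x => ‖φ x‖ ^ 2)
      (v := EuclideanSpace.single i 1) (by simpa only [e1] using i1) (by simpa only [e2] using i2)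
      (hs ((ci.mul cη).mul (cφ.norm.pow 2)) fun x hx => by simp [hx]) (fun x _ => (df i x).differentiableAt)
      (fun x _ => (dφ x).differentiableAt)
    simp only [e1, e2] at hibp
    rw [hibp]; ring
  have e : (fun x => (N * η (‖x‖ ^ 2) + 2 * ‖x‖ ^ 2 * η' (‖x‖ ^ 2)) * ‖φ x‖ ^ 2 +
      2 * η (‖x‖ ^ 2) * ∑ i, x i * inner ℝ (φ x) (fderiv ℝ φ x (EuclideanSpace.single i 1))) =
      fun x => ∑ i, ((η (‖x‖ ^ 2) + 2 * x i ^ 2 * η' (‖x‖ ^ 2)) * ‖φ x‖ ^ 2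
      + 2 * η (‖x‖ ^ 2) * (x i * inner ℝ (φ x) (fderiv ℝ φ x (EuclideanSpace.single i 1)))) := by
    ext x
    rw [Finset.sum_add_distrib, ← Finset.mul_sum, ← Finset.sum_mul, Finset.sum_add_distrib,
      ← Finset.sum_mul, ← Finset.mul_sum, sum_coord_sq]
    simp
  rw [e]
  refine ⟨integrable_finsetSum _ fun i _ => (key i).1, ?_⟩
  rw [integral_finsetSum _ fun i _ => (key i).1]
  exact Finset.sum_eq_zero fun i _ => (key i).2

/-- Rewriting ∇φ through D turns the coefficient Na + 2|x|²b into 2(a + |x|²b) ≥ a/2. Young's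
inequality on the cross term costs a²|x|²/4 ≤ (a+1)/4, which leaves a/4 - 1/4. -/
lemma div_radial_field_ge {N : ℕ} {a b : ℝ} {φ : EuclideanSpace ℝ (Fin N) → ℂ}
    {x : EuclideanSpace ℝ (Fin N)} (hx : x ≠ 0) (h1 : a / 2 ≤ 2 * (a + ‖x‖ ^ 2 * b))
    (h2 : a ^ 2 * ‖x‖ ^ 2 ≤ a + 1) :
    a / 4 * ‖φ x‖ ^ 2 - ‖φ x‖ ^ 2 / 4 - 4 * ∑ i, ‖shiftedPartial φ i x‖ ^ 2 ≤
    (N * a + 2 * ‖x‖ ^ 2 * b) * ‖φ x‖ ^ 2 +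
      2 * a * ∑ i, x i * inner ℝ (φ x) (fderiv ℝ φ x (EuclideanSpace.single i 1)) := by
  have hs : ‖x‖ ^ 2 ≠ 0 := by have := norm_pos_iff.mpr hx; positivity
  have e : ∑ i, x i * inner ℝ (φ x) (fderiv ℝ φ x (EuclideanSpace.single i 1)) =
      ∑ i, x i * inner ℝ (φ x) (shiftedPartial φ i x) - ((N : ℝ) - 2) / 2 * ‖φ x‖ ^ 2 := by
    have : ∀ i, x i * inner ℝ (φ x) (shiftedPartial φ i x) =
        x i * inner ℝ (φ x) (fderiv ℝ φ x (EuclideanSpace.single i 1)) +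
          x i ^ 2 * (((N : ℝ) - 2) / 2 * ‖φ x‖ ^ 2 / ‖x‖ ^ 2) := fun i => by
      rw [shiftedPartial, inner_add_right, inner_smul_right, real_inner_self_eq_norm_sq]
      ring
    simp only [this]
    rw [Finset.sum_add_distrib, ← Finset.sum_mul, sum_coord_sq]
    field_simp
    ring
  have hsum : -(2 * a * ∑ i, x i * inner ℝ (φ x) (shiftedPartial φ i x)) ≤
      a ^ 2 * ‖x‖ ^ 2 * ‖φ x‖ ^ 2 / 4 + 4 * ∑ i, ‖shiftedPartial φ i x‖ ^ 2 := by
    have : ∀ i, -(2 * a * (x i * inner ℝ (φ x) (shiftedPartial φ i x))) ≤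
        x i ^ 2 * (a ^ 2 * ‖φ x‖ ^ 2 / 4) + 4 * ‖shiftedPartial φ i x‖ ^ 2 := fun i => by
      have hc := abs_real_inner_le_norm (φ x) (shiftedPartial φ i x)
      have h3 : -(2 * a * (x i * inner ℝ (φ x) (shiftedPartial φ i x))) ≤
          2 * (|a * x i| * (‖φ x‖ * ‖shiftedPartial φ i x‖)) := by
        calc _ ≤ |-(2 * a * (x i * inner ℝ (φ x) (shiftedPartial φ i x)))| := le_abs_self _
          _ = 2 * (|a * x i| * |inner ℝ (φ x) (shiftedPartial φ i x)|) := by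
            rw [abs_neg, ← abs_mul, ← abs_two, ← abs_mul, abs_two]; congr 1; ring
          _ ≤ _ := by gcongr
      -- Young's inequality balanced so that |φ|² gets 1/4 and the energy gets 4.
      have h4 := sq_nonneg (|a * x i| * ‖φ x‖ / 2 - 2 * ‖shiftedPartial φ i x‖)
      have h5 := sq_abs (a * x i)
      nlinarith
    calc _ = ∑ i, -(2 * a * (x i * inner ℝ (φ x) (shiftedPartial φ i x))) := by
          rw [Finset.mul_sum, Finset.sum_neg_distrib]
      _ ≤ ∑ i, (x i ^ 2 * (a ^ 2 * ‖φ x‖ ^ 2 / 4) + 4 * ‖shiftedPartial φ i x‖ ^ 2) :=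
          Finset.sum_le_sum fun i _ => this i
      _ = _ := by rw [Finset.sum_add_distrib, ← Finset.sum_mul, ← Finset.mul_sum, sum_coord_sq]; ring
  rw [e]
  have p := sq_nonneg ‖φ x‖
  have m1 := mul_le_mul_of_nonneg_right h1 p
  have m2 := mul_le_mul_of_nonneg_right h2 p
  linarith

/-- A Hardy inequality with the subcritical weight `|x|^{-3/2}`, regularised at the origin. -/
lemma integral_weight_mul_norm_sq_le {N : ℕ} (hN : 3 ≤ N) {φ : EuclideanSpace ℝ (Fin N) → ℂ}
    (hφ : ContDiff ℝ ∞ φ) (h : HasCompactSupport φ) {ε : ℝ} (hε : 0 < ε) :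
    Integrable (fun x => (‖x‖ ^ 2 + ε) ^ (-3 / 4 : ℝ) * ‖φ x‖ ^ 2) ∧
    ∫ x, (‖x‖ ^ 2 + ε) ^ (-3 / 4 : ℝ) * ‖φ x‖ ^ 2 ≤
      16 * (∫ x, ∑ i, ‖shiftedPartial φ i x‖ ^ 2) + ∫ x, ‖φ x‖ ^ 2 := by
  have : Nonempty (Fin N) := ⟨⟨0, by lia⟩⟩
  have hpos : ∀ x : EuclideanSpace ℝ (Fin N), 0 < ‖x‖ ^ 2 + ε := fun x => by positivity
  have i1 : Integrable (fun x => (‖x‖ ^ 2 + ε) ^ (-3 / 4 : ℝ) * ‖φ x‖ ^ 2) := by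
    refine Continuous.integrable_of_hasCompactSupport ?_ (h.mono fun x hx => ?_)
    · have := hφ.continuous
      exact ((by fun_prop : Continuous fun x : EuclideanSpace ℝ (Fin N) => ‖x‖ ^ 2 + ε).rpow_const
        fun x => Or.inl (hpos x).ne').mul (by fun_prop)
    · simp only [Function.mem_support] at hx ⊢
      exact fun h0 => hx (by simp [h0])
  refine ⟨i1, ?_⟩
  have i2 := Continuous.integrable_norm_sq hφ.continuous h
  have i3 := integrable_sum_norm_sq_shiftedPartial hN hφ h
  -- For η = (s+ε)^{-3/4}, η + sη' ≥ η/4: an exponent above -1 keeps this positive, where the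
  -- critical |x|⁻² would give zero in the limit.
  have hη : ∀ s : ℝ, 0 ≤ s → HasDerivAt (fun s : ℝ => (s + ε) ^ (-3 / 4 : ℝ))
      (1 * (-3 / 4) * (s + ε) ^ (-3 / 4 - 1 : ℝ)) s := fun s hs =>
    ((hasDerivAt_id s).add_const ε).rpow_const (Or.inl (by simp only [id]; positivity))
  have hη' : ContinuousOn (fun s : ℝ => 1 * (-3 / 4) * (s + ε) ^ (-3 / 4 - 1 : ℝ)) (Set.Ici 0) := by
    refine ContinuousOn.mul continuousOn_const (ContinuousOn.rpow_const (by fun_prop) ?_)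
    exact fun s hs => Or.inl (by have : 0 ≤ s := hs; positivity)
  obtain ⟨i4, h0⟩ := integral_div_radial_field_eq_zero hη hη' hφ h
  have hle : ∫ x, ((‖x‖ ^ 2 + ε) ^ (-3 / 4 : ℝ) * ‖φ x‖ ^ 2 / 4 - ‖φ x‖ ^ 2 / 4 -
      4 * ∑ i, ‖shiftedPartial φ i x‖ ^ 2) ≤ 0 := by
    rw [← h0]
    refine integral_mono_ae (((i1.div_const 4).sub (i2.div_const 4)).sub (i3.const_mul 4)) i4 ?_
    filter_upwards [Measure.ae_ne volume (0 : EuclideanSpace ℝ (Fin N))] with x hx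
    have ht := hpos x
    set t := ‖x‖ ^ 2 + ε with htd
    have hst : ‖x‖ ^ 2 ≤ t := by linarith
    have hb : t * t ^ (-3 / 4 - 1 : ℝ) = t ^ (-3 / 4 : ℝ) := by
      rw [Real.rpow_sub_one ht.ne']; field_simp
    have hn : 0 ≤ t ^ (-3 / 4 - 1 : ℝ) := by positivity
    refine le_trans (le_of_eq ?_) (div_radial_field_ge (a := t ^ (-3 / 4 : ℝ)) (φ := φ) hx ?_ ?_)
    · ring
    · have := mul_le_mul_of_nonneg_right hst hn
      linarith
    · calc (t ^ (-3 / 4 : ℝ)) ^ 2 * ‖x‖ ^ 2 ≤ (t ^ (-3 / 4 : ℝ)) ^ 2 * t := by gcongr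
        _ = t ^ (-1 / 2 : ℝ) := by
          rw [← Real.rpow_natCast, ← Real.rpow_mul ht.le, ← Real.rpow_add_one ht.ne']
          norm_num
        _ ≤ t ^ (-3 / 4 : ℝ) + 1 := by
          rcases le_total t 1 with h1 | h1
          · have := Real.rpow_le_rpow_of_exponent_ge ht h1 (by norm_num : (-3 / 4 : ℝ) ≤ -1 / 2)
            linarith
          · have := Real.rpow_le_one_of_one_le_of_nonpos h1 (by norm_num : (-1 / 2 : ℝ) ≤ 0)
            have : 0 < t ^ (-3 / 4 : ℝ) := by positivity
            linarith
  have e := integral_sub ((i1.div_const 4).sub (i2.div_const 4)) (i3.const_mul 4)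
  simp only [Pi.sub_apply] at e
  rw [e, integral_sub (i1.div_const 4) (i2.div_const 4), integral_div, integral_div,
    integral_const_mul] at hle
  linarith

/-! ### Sobolev inequality in integral form -/

lemma norm_sq_le_sum_norm_sq_single {N : ℕ} (T : EuclideanSpace ℝ (Fin N) →L[ℝ] ℂ) :
    ‖T‖ ^ 2 ≤ ∑ i, ‖T (EuclideanSpace.single i 1)‖ ^ 2 := by
  refine (Real.le_sqrt (norm_nonneg _) (by positivity)).mp
    (T.opNorm_le_bound (Real.sqrt_nonneg _) fun x => ?_)
  have hx : T x = ∑ i, x i • T (EuclideanSpace.single i 1) := by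
    conv_lhs => rw [← (EuclideanSpace.basisFun (Fin N) ℝ).sum_repr x]
    simp
  calc ‖T x‖ ≤ ∑ i, ‖T (EuclideanSpace.single i 1)‖ * ‖x i‖ := by
        rw [hx]
        refine (norm_sum_le _ _).trans (Finset.sum_le_sum fun i _ => ?_)
        rw [norm_smul, mul_comm]
    _ ≤ √(∑ i, ‖T (EuclideanSpace.single i 1)‖ ^ 2) * √(∑ i, ‖x i‖ ^ 2) :=
        Real.sum_mul_le_sqrt_mul_sqrt _ _ _
    _ = _ := by rw [← EuclideanSpace.norm_eq]

lemma sobolev_inequality (N : ℕ) (hN : 3 ≤ N) :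
    ∃ S : ℝ, 0 ≤ S ∧ ∀ w : EuclideanSpace ℝ (Fin N) → ℂ, ContDiff ℝ 1 w → HasCompactSupport w →
      (∫ x, ‖w x‖ ^ criticalExponent N) ^ (((N : ℝ) - 2) / (N : ℝ)) ≤
        S * ∫ x, ‖fderiv ℝ w x‖ ^ 2 := by
  have hN' : (3 : ℝ) ≤ N := by exact_mod_cast hN
  have hN2 : (0 : ℝ) < N - 2 := by linarith
  have hp0 : 0 < criticalExponent N := by unfold criticalExponent; positivity
  set K := SNormLESNormFDerivOfEqConst ℂ (volume : Measure (EuclideanSpace ℝ (Fin N))) 2 with hK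
  obtain ⟨P, hP⟩ : ∃ P : NNReal, (P : ℝ) = criticalExponent N := ⟨⟨_, hp0.le⟩, rfl⟩
  have hP0 : P ≠ 0 := fun h => by simp [← hP, h] at hp0
  refine ⟨(K : ℝ) ^ 2, by positivity, fun w hw h => ?_⟩
  have hS := eLpNorm_le_eLpNorm_fderiv_of_eq (volume : Measure (EuclideanSpace ℝ (Fin N))) hw h
    (p := 2) (p' := P) (by norm_num) (by simp; lia) (by
      rw [hP, finrank_euclideanSpace, Fintype.card_fin, criticalExponent, NNReal.coe_inv,
        NNReal.coe_ofNat]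
      field_simp)
  have m1 : MemLp w (P : ENNReal) :=
    hw.continuous.memLp_of_hasCompactSupport h
  have m2 : MemLp (fderiv ℝ w) ((2 : NNReal) : ENNReal) :=
    (hw.continuous_fderiv (by simp)).memLp_of_hasCompactSupport (h.fderiv ℝ)
  rw [m1.eLpNorm_eq_integral_rpow_norm (by simpa using hP0) (by simp),
    m2.eLpNorm_eq_integral_rpow_norm (by simp) (by simp), NNReal.coe_ofNat, ← hK,
    ← ENNReal.ofReal_coe_nnreal (p := K), ← ENNReal.ofReal_mul (by positivity),
    ENNReal.ofReal_le_ofReal_iff (by positivity)] at hS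
  simp only [ENNReal.coe_toReal, hP, NNReal.coe_ofNat, Real.rpow_two] at hS
  set A := ∫ x, ‖w x‖ ^ criticalExponent N
  have hA : 0 ≤ A := by positivity
  set B := ∫ x, ‖fderiv ℝ w x‖ ^ 2
  have hB : 0 ≤ B := by positivity
  calc A ^ (((N : ℝ) - 2) / N) = (A ^ (criticalExponent N)⁻¹) ^ 2 := by
        rw [← Real.rpow_natCast (_ ^ _), ← Real.rpow_mul hA]
        congr 1
        unfold criticalExponent
        push_cast
        field_simp
    _ ≤ (K * B ^ (2 : ℝ)⁻¹) ^ 2 := by gcongr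
    _ = K ^ 2 * B := by
        rw [mul_pow, ← Real.rpow_natCast (B ^ _), ← Real.rpow_mul hB]
        norm_num

/-! ### Regularised weight and the gradient of the weighted function -/

/-- A smooth positive approximation of `hardyWeight ^ p`, as a function of `s = |x|²`. -/
noncomputable def regWeight (p ε s : ℝ) : ℝ := ((s + ε) / (s + 1)) ^ p

section
variable {p ε s : ℝ}

lemma hasDerivAt_regWeight (hε : 0 < ε) (hs : 0 ≤ s) :
    HasDerivAt (regWeight p ε) (regWeight p ε s * (p * ((s + ε)⁻¹ - (s + 1)⁻¹))) s := by
  have h1 : 0 < s + ε := by positivity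
  have h2 : 0 < s + 1 := by positivity
  have h := (((hasDerivAt_id s).add_const ε).div ((hasDerivAt_id s).add_const 1)
    h2.ne').rpow_const (p := p) (Or.inl (by simp only [Pi.div_apply, id]; positivity))
  refine h.congr_deriv ?_
  simp only [Pi.div_apply, id, regWeight]
  rw [Real.rpow_sub_one (by positivity)]
  field_simp

lemma regWeight_nonneg (hε : 0 < ε) (hs : 0 ≤ s) : 0 ≤ regWeight p ε s := by
  unfold regWeight; positivity

lemma regWeight_le_one (hp : 0 ≤ p) (hε : 0 < ε) (hε1 : ε ≤ 1) (hs : 0 ≤ s) :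
    regWeight p ε s ≤ 1 := by
  refine Real.rpow_le_one (by positivity) ?_ hp
  rw [div_le_one (by positivity)]; linarith

/-- Split (s+ε)^{2p} = (s+ε)(s+ε)^{2p-1} into its s and ε parts. Since -3/4 ≤ 2p-1 ≤ 0, the s part
gives the subcritical weight plus 1, and the ε part is at most ε^{2p}. -/
lemma regWeight_sq_div_le (hp : 1 / 4 ≤ 2 * p) (hp1 : 2 * p ≤ 1) (hε : 0 < ε) (hs : 0 < s) :
    regWeight p ε s ^ 2 / s ≤ (s + ε) ^ (-3 / 4 : ℝ) + 1 + ε ^ (2 * p) / s := by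
  have ht : 0 < s + ε := by positivity
  have h1 : regWeight p ε s ^ 2 ≤ (s + ε) ^ (2 * p) := by
    unfold regWeight
    rw [← Real.rpow_natCast, ← Real.rpow_mul (by positivity), mul_comm 2 p]
    refine Real.rpow_le_rpow (by positivity) (div_le_self ht.le (by linarith)) ?_
    push_cast; linarith
  have h2 : (s + ε) ^ (2 * p) = s * (s + ε) ^ (2 * p - 1) + ε * (s + ε) ^ (2 * p - 1) := by
    rw [Real.rpow_sub_one ht.ne']; field_simp
  have h3 : ε * (s + ε) ^ (2 * p - 1) ≤ ε ^ (2 * p) := by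
    have : ε ^ (2 * p) = ε * ε ^ (2 * p - 1) := by rw [Real.rpow_sub_one hε.ne']; field_simp
    rw [this]
    refine mul_le_mul_of_nonneg_left ?_ hε.le
    exact Real.rpow_le_rpow_of_nonpos hε (by linarith) (by linarith)
  have h4 : (s + ε) ^ (2 * p - 1) ≤ (s + ε) ^ (-3 / 4 : ℝ) + 1 := by
    rcases le_total (s + ε) 1 with h | h
    · have := Real.rpow_le_rpow_of_exponent_ge ht h (by linarith : (-3 / 4 : ℝ) ≤ 2 * p - 1)
      linarith
    · have := Real.rpow_le_one_of_one_le_of_nonpos h (by linarith : 2 * p - 1 ≤ 0)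
      have : 0 < (s + ε) ^ (-3 / 4 : ℝ) := by positivity
      linarith
  calc regWeight p ε s ^ 2 / s ≤ (s * (s + ε) ^ (2 * p - 1) + ε ^ (2 * p)) / s := by
        gcongr; linarith
    _ = (s + ε) ^ (2 * p - 1) + ε ^ (2 * p) / s := by field_simp
    _ ≤ _ := by linarith

/-- This is the coefficient β left over when ∇(Fφ) is expressed through D. It is a difference of two
nonnegative terms, each at most m·F/s. -/
lemma abs_two_mul_deriv_regWeight_sub_le {c m : ℝ} (hp : 0 ≤ p) (hc : 0 ≤ c) (hpm : 2 * p ≤ m)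
    (hcm : c ≤ m) (hε : 0 < ε) (hε1 : ε ≤ 1) (hs : 0 < s) :
    |2 * (regWeight p ε s * (p * ((s + ε)⁻¹ - (s + 1)⁻¹))) - c * regWeight p ε s / s| ≤
      m * (regWeight p ε s / s) := by
  have hF := regWeight_nonneg (p := p) hε hs.le
  have hd0 : 0 ≤ (s + ε)⁻¹ - (s + 1)⁻¹ :=
    sub_nonneg.mpr (inv_anti₀ (by positivity) (by linarith))
  have hd1 : (s + ε)⁻¹ - (s + 1)⁻¹ ≤ s⁻¹ := by
    have : (s + ε)⁻¹ ≤ s⁻¹ := inv_anti₀ hs (by linarith)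
    have : 0 < (s + 1)⁻¹ := by positivity
    linarith
  have e : 2 * (regWeight p ε s * (p * ((s + ε)⁻¹ - (s + 1)⁻¹))) - c * regWeight p ε s / s =
      regWeight p ε s * (2 * p * ((s + ε)⁻¹ - (s + 1)⁻¹) - c * s⁻¹) := by
    rw [div_eq_mul_inv]; ring
  have hsi : 0 < s⁻¹ := by positivity
  rw [e, abs_mul, abs_of_nonneg hF, div_eq_mul_inv, mul_left_comm]
  refine mul_le_mul_of_nonneg_left (abs_le.mpr ⟨?_, ?_⟩) hF
  · have := mul_le_mul_of_nonneg_right hcm hsi.le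
    have : 0 ≤ 2 * p * ((s + ε)⁻¹ - (s + 1)⁻¹) := by positivity
    linarith
  · have hm : 0 ≤ m := hc.trans hcm
    have h1 : 2 * p * ((s + ε)⁻¹ - (s + 1)⁻¹) ≤ m * s⁻¹ := by gcongr
    have : 0 ≤ c * s⁻¹ := by positivity
    linarith

end

lemma sum_norm_sq_fderiv_regWeight_smul_le {N : ℕ} (hN : 3 ≤ N) {p ε : ℝ} (hp : 1 / 4 ≤ 2 * p)
    (hp1 : 2 * p ≤ 1) (hε : 0 < ε) (hε1 : ε ≤ 1) {φ : EuclideanSpace ℝ (Fin N) → ℂ}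
    {x : EuclideanSpace ℝ (Fin N)} (hx : x ≠ 0) (hφ : DifferentiableAt ℝ φ x) :
    ∑ i, ‖fderiv ℝ (fun y => regWeight p ε (‖y‖ ^ 2) • φ y) x (EuclideanSpace.single i 1)‖ ^ 2 ≤
      2 * ∑ i, ‖shiftedPartial φ i x‖ ^ 2 + 2 * (N : ℝ) ^ 2 *
        ((‖x‖ ^ 2 + ε) ^ (-3 / 4 : ℝ) * ‖φ x‖ ^ 2 + ‖φ x‖ ^ 2 +
          ε ^ (2 * p) * (‖φ x‖ ^ 2 / ‖x‖ ^ 2)) := by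
  have hN' : (3 : ℝ) ≤ N := by exact_mod_cast hN
  have hs : 0 < ‖x‖ ^ 2 := by have := norm_pos_iff.mpr hx; positivity
  have hF0 := regWeight_nonneg (p := p) hε hs.le
  have hF1 := regWeight_le_one (p := p) (by linarith) hε hε1 hs.le
  have hβ := abs_two_mul_deriv_regWeight_sub_le (p := p) (c := ((N : ℝ) - 2) / 2) (m := N)
    (by linarith) (by linarith) (by linarith) (by linarith) hε hε1 hs
  have hq := regWeight_sq_div_le hp hp1 hε hs
  simp only [fderiv_radial_smul_single_shifted x (hasDerivAt_regWeight (p := p) hε hs.le) hφ]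
  set β := 2 * (regWeight p ε (‖x‖ ^ 2) * (p * ((‖x‖ ^ 2 + ε)⁻¹ - (‖x‖ ^ 2 + 1)⁻¹))) -
    ((N : ℝ) - 2) / 2 * regWeight p ε (‖x‖ ^ 2) / ‖x‖ ^ 2
  set F := regWeight p ε (‖x‖ ^ 2)
  have hi : ∀ i, ‖F • shiftedPartial φ i x + (x i * β) • φ x‖ ^ 2 ≤
      2 * ‖shiftedPartial φ i x‖ ^ 2 + x i ^ 2 * (2 * β ^ 2 * ‖φ x‖ ^ 2) := fun i => by
    calc _ ≤ (‖F • shiftedPartial φ i x‖ + ‖(x i * β) • φ x‖) ^ 2 := by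
          gcongr; exact norm_add_le _ _
      _ ≤ 2 * (‖F • shiftedPartial φ i x‖ ^ 2 + ‖(x i * β) • φ x‖ ^ 2) := add_sq_le
      _ = 2 * (F ^ 2 * ‖shiftedPartial φ i x‖ ^ 2) + x i ^ 2 * (2 * β ^ 2 * ‖φ x‖ ^ 2) := by
          rw [norm_smul, norm_smul, mul_pow, mul_pow, Real.norm_eq_abs, Real.norm_eq_abs, sq_abs,
            sq_abs]
          ring
      _ ≤ _ := by
          gcongr
          exact mul_le_of_le_one_left (by positivity) (pow_le_one₀ hF0 hF1)
  have hβ2 : ‖x‖ ^ 2 * β ^ 2 ≤ (N : ℝ) ^ 2 * (F ^ 2 / ‖x‖ ^ 2) := by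
    calc ‖x‖ ^ 2 * β ^ 2 = ‖x‖ ^ 2 * |β| ^ 2 := by rw [sq_abs]
      _ ≤ ‖x‖ ^ 2 * (N * (F / ‖x‖ ^ 2)) ^ 2 := by gcongr
      _ = _ := by field_simp
  calc _ ≤ ∑ i, (2 * ‖shiftedPartial φ i x‖ ^ 2 + x i ^ 2 * (2 * β ^ 2 * ‖φ x‖ ^ 2)) :=
        Finset.sum_le_sum fun i _ => hi i
    _ = 2 * ∑ i, ‖shiftedPartial φ i x‖ ^ 2 + 2 * (‖x‖ ^ 2 * β ^ 2) * ‖φ x‖ ^ 2 := by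
        rw [Finset.sum_add_distrib, ← Finset.sum_mul, ← Finset.mul_sum, sum_coord_sq]; ring
    _ ≤ 2 * ∑ i, ‖shiftedPartial φ i x‖ ^ 2 + 2 * ((N : ℝ) ^ 2 *
        ((‖x‖ ^ 2 + ε) ^ (-3 / 4 : ℝ) + 1 + ε ^ (2 * p) / ‖x‖ ^ 2)) * ‖φ x‖ ^ 2 := by
        have := hβ2.trans (mul_le_mul_of_nonneg_left hq (by positivity))
        gcongr 2 * ∑ i, ‖shiftedPartial φ i x‖ ^ 2 + 2 * ?_ * ‖φ x‖ ^ 2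
    _ = _ := by ring

/-! ### Comparison with the weight h -/

lemma measurable_hardyWeight {N : ℕ} : Measurable (hardyWeight (N := N)) := by
  unfold hardyWeight
  exact Measurable.ite (measurableSet_lt measurable_norm measurable_const) (by fun_prop)
    measurable_const

lemma hardyWeight_nonneg {N : ℕ} (x : EuclideanSpace ℝ (Fin N)) : 0 ≤ hardyWeight x := by
  unfold hardyWeight; split_ifs <;> positivity

lemma hardyWeight_le_one {N : ℕ} (x : EuclideanSpace ℝ (Fin N)) : hardyWeight x ≤ 1 := by
  unfold hardyWeight
  split_ifs with h
  · exact pow_le_one₀ (norm_nonneg x) h.le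
  · exact le_rfl

/-- The factor 2 is uniform in ε: |x|²+1 is at most 2 inside the unit ball and at most 2|x|²
outside. -/
lemma hardyWeight_le {N : ℕ} (x : EuclideanSpace ℝ (Fin N)) {ε : ℝ} (hε : 0 < ε) :
    hardyWeight x ≤ 2 * ((‖x‖ ^ 2 + ε) / (‖x‖ ^ 2 + 1)) := by
  have h0 : 0 ≤ ‖x‖ ^ 2 := by positivity
  rw [← mul_div_assoc, le_div_iff₀ (by positivity)]
  unfold hardyWeight
  split_ifs with h
  · have := pow_le_one₀ (n := 2) (norm_nonneg x) h.le
    nlinarith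
  · have := one_le_pow₀ (n := 2) (not_lt.mp h)
    linarith

lemma Continuous.integrable_norm_rpow {N : ℕ} {φ : EuclideanSpace ℝ (Fin N) → ℂ}
    (hφ : Continuous φ) (h : HasCompactSupport φ) {q : ℝ} (hq : 0 < q) :
    Integrable (fun x => ‖φ x‖ ^ q) := by
  refine Continuous.integrable_of_hasCompactSupport
    (hφ.norm.rpow_const fun _ => Or.inr hq.le) ?_
  exact h.norm.comp_left (g := fun t : ℝ => t ^ q) (Real.zero_rpow hq.ne')

lemma integrable_hardyWeight_mul {N : ℕ} {f : EuclideanSpace ℝ (Fin N) → ℝ} (hf : Integrable f) :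
    Integrable (fun x => hardyWeight x * f x) := by
  refine hf.bdd_mul (c := 1) measurable_hardyWeight.aestronglyMeasurable (ae_of_all _ fun x => ?_)
  rw [Real.norm_of_nonneg (hardyWeight_nonneg x)]
  exact hardyWeight_le_one x

lemma contDiff_regWeight_smul {N : ℕ} {p ε : ℝ} (hε : 0 < ε)
    {φ : EuclideanSpace ℝ (Fin N) → ℂ} (hφ : ContDiff ℝ ∞ φ) :
    ContDiff ℝ 1 (fun y => regWeight p ε (‖y‖ ^ 2) • φ y) := by
  have hn : ContDiff ℝ 1 fun y : EuclideanSpace ℝ (Fin N) => ‖y‖ ^ 2 := contDiff_norm_sq ℝ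
  have hw : ContDiff ℝ 1 fun y : EuclideanSpace ℝ (Fin N) => regWeight p ε (‖y‖ ^ 2) :=
    ((hn.add contDiff_const).div (hn.add contDiff_const) fun x => by positivity)
      |>.rpow_const_of_ne fun x => ne_of_gt <|
        (by positivity : 0 < (‖x‖ ^ 2 + ε) / (‖x‖ ^ 2 + 1))
  exact hw.smul (hφ.of_le (mod_cast (le_top : (1 : ℕ∞) ≤ ⊤)))

lemma hasCompactSupport_regWeight_smul {N : ℕ} {p ε : ℝ} {φ : EuclideanSpace ℝ (Fin N) → ℂ}
    (h : HasCompactSupport φ) :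
    HasCompactSupport (fun y => regWeight p ε (‖y‖ ^ 2) • φ y) :=
  h.mono fun x hx => by
    simp only [Function.mem_support] at hx ⊢
    exact fun h0 => hx (by rw [h0, smul_zero])

/-- As pq = 1, the q-th power of the regularised weight is the plain quotient, which dominates h/2;
then 2^θ ≤ 2. -/
lemma rpow_integral_hardyWeight_le {N : ℕ} {p q θ ε : ℝ} (hq : 0 < q) (hpq : p * q = 1)
    (hθ0 : 0 ≤ θ) (hθ1 : θ ≤ 1) (hε : 0 < ε) {φ : EuclideanSpace ℝ (Fin N) → ℂ}
    (hφ : ContDiff ℝ ∞ φ) (h : HasCompactSupport φ) :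
    (∫ x, hardyWeight x * ‖φ x‖ ^ q) ^ θ ≤
      2 * (∫ x, ‖regWeight p ε (‖x‖ ^ 2) • φ x‖ ^ q) ^ θ := by
  have hpt : ∀ x, hardyWeight x * ‖φ x‖ ^ q ≤ 2 * ‖regWeight p ε (‖x‖ ^ 2) • φ x‖ ^ q := by
    intro x
    have hg : 0 ≤ (‖x‖ ^ 2 + ε) / (‖x‖ ^ 2 + 1) := by positivity
    have : ‖regWeight p ε (‖x‖ ^ 2) • φ x‖ ^ q =
        (‖x‖ ^ 2 + ε) / (‖x‖ ^ 2 + 1) * ‖φ x‖ ^ q := by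
      rw [norm_smul, Real.norm_of_nonneg (regWeight_nonneg hε (by positivity)),
        Real.mul_rpow (regWeight_nonneg hε (by positivity)) (norm_nonneg _), regWeight,
        ← Real.rpow_mul hg, hpq, Real.rpow_one]
    rw [this, ← mul_assoc]
    exact mul_le_mul_of_nonneg_right (hardyWeight_le x hε) (by positivity)
  have hi : ∫ x, hardyWeight x * ‖φ x‖ ^ q ≤
      2 * ∫ x, ‖regWeight p ε (‖x‖ ^ 2) • φ x‖ ^ q := by
    rw [← integral_const_mul]
    exact integral_mono
      (integrable_hardyWeight_mul (Continuous.integrable_norm_rpow hφ.continuous h hq))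
      ((Continuous.integrable_norm_rpow (contDiff_regWeight_smul hε hφ).continuous
        (hasCompactSupport_regWeight_smul h) hq).const_mul 2) hpt
  calc _ ≤ (2 * ∫ x, ‖regWeight p ε (‖x‖ ^ 2) • φ x‖ ^ q) ^ θ := by
        refine Real.rpow_le_rpow (integral_nonneg fun x => ?_) hi hθ0
        exact mul_nonneg (hardyWeight_nonneg x) (by positivity)
    _ = 2 ^ θ * (∫ x, ‖regWeight p ε (‖x‖ ^ 2) • φ x‖ ^ q) ^ θ :=
        Real.mul_rpow (by norm_num) (integral_nonneg fun x => by positivity)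
    _ ≤ _ := by
        refine mul_le_mul_of_nonneg_right ?_
          (Real.rpow_nonneg (integral_nonneg fun x => by positivity) _)
        exact (Real.rpow_le_rpow_of_exponent_le (by norm_num) hθ1).trans_eq (Real.rpow_one 2)

lemma integral_norm_sq_fderiv_regWeight_smul_le {N : ℕ} (hN : 3 ≤ N) {p ε : ℝ}
    (hp : 1 / 4 ≤ 2 * p) (hp1 : 2 * p ≤ 1) (hε : 0 < ε) (hε1 : ε ≤ 1)
    {φ : EuclideanSpace ℝ (Fin N) → ℂ} (hφ : ContDiff ℝ ∞ φ) (h : HasCompactSupport φ) :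
    ∫ x, ‖fderiv ℝ (fun y => regWeight p ε (‖y‖ ^ 2) • φ y) x‖ ^ 2 ≤
      34 * (N : ℝ) ^ 2 * ((∫ x, ∑ i, ‖shiftedPartial φ i x‖ ^ 2) + ∫ x, ‖φ x‖ ^ 2) +
        2 * (N : ℝ) ^ 2 * (ε ^ (2 * p) * ∫ x, ‖φ x‖ ^ 2 / ‖x‖ ^ 2) := by
  have hN' : (3 : ℝ) ≤ N := by exact_mod_cast hN
  have : Nonempty (Fin N) := ⟨⟨0, by lia⟩⟩
  have hwc := contDiff_regWeight_smul (p := p) hε hφ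
  have hws := hasCompactSupport_regWeight_smul (p := p) (ε := ε) h
  obtain ⟨i1, hH⟩ := integral_weight_mul_norm_sq_le hN hφ h hε
  have i2 := Continuous.integrable_norm_sq hφ.continuous h
  have i3 := integrable_sum_norm_sq_shiftedPartial hN hφ h
  have i4 := integrable_norm_sq_div_norm_sq hN hφ.continuous h
  have i5 : Integrable fun x =>
      ‖fderiv ℝ (fun y => regWeight p ε (‖y‖ ^ 2) • φ y) x‖ ^ 2 := by
    refine Continuous.integrable_of_hasCompactSupport
      ((hwc.continuous_fderiv (by simp)).norm.pow 2) ?_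
    exact (hws.fderiv ℝ).norm.comp_left (g := fun t : ℝ => t ^ 2) (by simp)
  have j1 : Integrable fun x => (‖x‖ ^ 2 + ε) ^ (-3 / 4 : ℝ) * ‖φ x‖ ^ 2 + ‖φ x‖ ^ 2 := i1.add i2
  have j2 : Integrable fun x => (‖x‖ ^ 2 + ε) ^ (-3 / 4 : ℝ) * ‖φ x‖ ^ 2 + ‖φ x‖ ^ 2 +
      ε ^ (2 * p) * (‖φ x‖ ^ 2 / ‖x‖ ^ 2) := j1.add (i4.const_mul _)
  have hG : ∫ x, ‖fderiv ℝ (fun y => regWeight p ε (‖y‖ ^ 2) • φ y) x‖ ^ 2 ≤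
      2 * (∫ x, ∑ i, ‖shiftedPartial φ i x‖ ^ 2) +
      2 * (N : ℝ) ^ 2 * ((∫ x, (‖x‖ ^ 2 + ε) ^ (-3 / 4 : ℝ) * ‖φ x‖ ^ 2) + (∫ x, ‖φ x‖ ^ 2) +
        ε ^ (2 * p) * ∫ x, ‖φ x‖ ^ 2 / ‖x‖ ^ 2) := by
    rw [← integral_const_mul, ← integral_const_mul (ε ^ (2 * p)), ← integral_add i1 i2,
      ← integral_add j1 (i4.const_mul _), ← integral_const_mul,
      ← integral_add (i3.const_mul 2) (j2.const_mul _)]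
    refine integral_mono_ae i5 ((i3.const_mul 2).add (j2.const_mul _)) ?_
    filter_upwards [Measure.ae_ne volume (0 : EuclideanSpace ℝ (Fin N))] with x hx
    exact (norm_sq_le_sum_norm_sq_single _).trans
      (sum_norm_sq_fderiv_regWeight_smul_le hN hp hp1 hε hε1 hx
        (hφ.differentiable (by simp) x))
  have hE : 0 ≤ ∫ x, ∑ i, ‖shiftedPartial φ i x‖ ^ 2 := by positivity
  have hM : 0 ≤ ∫ x, ‖φ x‖ ^ 2 := by positivity
  -- Collecting constants: 2E + 2N²(16E + 2M) ≤ 34N²(E + M), using N² ≥ 1.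
  have hN1 : 1 ≤ (N : ℝ) ^ 2 := by nlinarith
  have h1 := mul_le_mul_of_nonneg_left hH (by positivity : 0 ≤ 2 * (N : ℝ) ^ 2)
  have h2 := mul_le_mul_of_nonneg_right hN1 hE
  have h3 : 0 ≤ (N : ℝ) ^ 2 * ∫ x, ‖φ x‖ ^ 2 := by positivity
  linarith

/-! ### Assembly and the limit ε → 0 -/

/-- The inequality up to an error that vanishes as `ε → 0`. -/
lemma regularized_hardy_sobolev {N : ℕ} (hN : 3 ≤ N) {S : ℝ} (hS : 0 ≤ S)
    (hSob : ∀ w : EuclideanSpace ℝ (Fin N) → ℂ, ContDiff ℝ 1 w → HasCompactSupport w →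
      (∫ x, ‖w x‖ ^ criticalExponent N) ^ (((N : ℝ) - 2) / (N : ℝ)) ≤
        S * ∫ x, ‖fderiv ℝ w x‖ ^ 2)
    {φ : EuclideanSpace ℝ (Fin N) → ℂ} (hφ : ContDiff ℝ ∞ φ) (h : HasCompactSupport φ)
    {ε : ℝ} (hε : 0 < ε) (hε1 : ε ≤ 1) :
    (∫ x, hardyWeight x * ‖φ x‖ ^ criticalExponent N) ^ (((N : ℝ) - 2) / (N : ℝ)) ≤
      2 * (S * (34 * (N : ℝ) ^ 2 * ((∫ x, ∑ i, ‖shiftedPartial φ i x‖ ^ 2) + ∫ x, ‖φ x‖ ^ 2) +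
        2 * (N : ℝ) ^ 2 * (ε ^ (((N : ℝ) - 2) / (N : ℝ)) * ∫ x, ‖φ x‖ ^ 2 / ‖x‖ ^ 2))) := by
  have hN' : (3 : ℝ) ≤ N := by exact_mod_cast hN
  have hN2 : (0 : ℝ) < N - 2 := by linarith
  have hp0 : 0 < criticalExponent N := by unfold criticalExponent; positivity
  have hθ0 : 0 < ((N : ℝ) - 2) / N := by positivity
  have hθ1 : ((N : ℝ) - 2) / N ≤ 1 := by rw [div_le_one (by positivity)]; linarith
  have hθ2 : 1 / 4 ≤ ((N : ℝ) - 2) / N := by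
    rw [div_le_div_iff₀ (by norm_num) (by positivity)]; linarith
  -- p = 1/2*; the bound 2p ≥ 1/4 has room to spare, since (N-2)/N ≥ 1/3.
  obtain ⟨p, hp⟩ : ∃ p, 2 * p = ((N : ℝ) - 2) / N := ⟨((N : ℝ) - 2) / N / 2, by ring⟩
  have hpc : p * criticalExponent N = 1 := by
    have : p = ((N : ℝ) - 2) / N / 2 := by linarith
    rw [this, criticalExponent]; field_simp
  refine (rpow_integral_hardyWeight_le hp0 hpc hθ0.le hθ1 hε hφ h).trans ?_
  refine mul_le_mul_of_nonneg_left ?_ zero_le_two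
  refine (hSob _ (contDiff_regWeight_smul hε hφ) (hasCompactSupport_regWeight_smul h)).trans ?_
  rw [← hp]
  exact mul_le_mul_of_nonneg_left (integral_norm_sq_fderiv_regWeight_smul_le hN (hp ▸ hθ2)
    (hp ▸ hθ1) hε hε1 hφ h) hS

theorem mainTheorem10 (N : ℕ) (hN : 3 ≤ N) :
    ∃ C : ℝ, 0 < C ∧
      ∀ φ : EuclideanSpace ℝ (Fin N) → ℂ, ContDiff ℝ ∞ φ → HasCompactSupport φ →
        Integrable (hardyEnergyDensity φ) ∧
        Integrable (fun x => ‖φ x‖ ^ 2) ∧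
        Integrable (fun x => hardyWeight x * ‖φ x‖ ^ criticalExponent N) ∧
        C * (∫ x, hardyWeight x * ‖φ x‖ ^ criticalExponent N) ^ (((N : ℝ) - 2) / (N : ℝ))
          ≤ energyNorm φ ^ 2 := by
  have hN' : (3 : ℝ) ≤ N := by exact_mod_cast hN
  have hN2 : (0 : ℝ) < N - 2 := by linarith
  have hp0 : 0 < criticalExponent N := by unfold criticalExponent; positivity
  have hθ0 : 0 < ((N : ℝ) - 2) / N := by positivity
  obtain ⟨S, hS, hSob⟩ := sobolev_inequality N hN
  -- 68 = 2·34; the added 1 keeps the constant invertible if S = 0 and is absorbed by the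
  -- nonnegative energy.
  refine ⟨(68 * S * (N : ℝ) ^ 2 + 1)⁻¹, by positivity, fun φ hφ h => ?_⟩
  have hae := hardyEnergyDensity_ae_eq hN hφ
  refine ⟨(integrable_sum_norm_sq_shiftedPartial hN hφ h).congr hae.symm,
    Continuous.integrable_norm_sq hφ.continuous h,
    integrable_hardyWeight_mul (Continuous.integrable_norm_rpow hφ.continuous h hp0), ?_⟩
  have hE : 0 ≤ ∫ x, ∑ i, ‖shiftedPartial φ i x‖ ^ 2 := by positivity
  have hM : 0 ≤ ∫ x, ‖φ x‖ ^ 2 := by positivity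
  rw [energyNorm, integral_congr_ae hae, Real.sq_sqrt (by positivity),
    inv_mul_le_iff₀ (by positivity)]
  have hlim : Filter.Tendsto (fun ε : ℝ => ε ^ (((N : ℝ) - 2) / (N : ℝ)))
      (nhdsWithin 0 (Set.Ioi 0)) (nhds 0) := by
    have := (Real.continuousAt_rpow_const 0 (((N : ℝ) - 2) / N) (Or.inr hθ0.le)).tendsto
    rw [Real.zero_rpow hθ0.ne'] at this
    exact this.mono_left nhdsWithin_le_nhds
  -- The left side does not depend on ε, so the bound survives the limit along (0, 1].
  have hle := ge_of_tendsto (((((hlim.mul_const (∫ x, ‖φ x‖ ^ 2 / ‖x‖ ^ 2)).const_mul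
    (2 * (N : ℝ) ^ 2)).const_add (34 * (N : ℝ) ^ 2 *
      ((∫ x, ∑ i, ‖shiftedPartial φ i x‖ ^ 2) + ∫ x, ‖φ x‖ ^ 2))).const_mul S).const_mul 2)
    (Filter.mem_of_superset (Ioc_mem_nhdsGT one_pos) fun ε hε =>
      regularized_hardy_sobolev hN hS hSob hφ h hε.1 hε.2)
  linarith
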